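/- Let $\Omega\subset\mathbb R^2$ be a billiard table: a bounded, not necessarily convex domain whose boundary is a simple closed curve of class $\mathcal C^3$ and of length $l>0$, parametrized by arc length $t\in S^1=\mathbb R/l\mathbb Z$ with $\Omega$ on the left. A point $(t,\theta)$ of the phase annulus $U=S^1\times(0,\pi)$ stands for the ball leaving the boundary point $\gamma(t)$ in the direction that makes the angle $\theta$ with the tangent $\gamma'(t)$. The billiard map $T$ is the partial map of $U$ with $T(t_1,\theta_1)=(t_2,\theta_2)$ if the ball leaving according to $(t_1,\theta_1)$ moves along a straight segment in $\overline\Omega$ whose next non-tangential contact with $\partial\Omega$ is at $\gamma(t_2)$, and is reflected there, by the law of equal angles, into the direction making the angle $\theta_2\in(0,\pi)$ with $\gamma'(t_2)$. Let $P^3\subset U$ be the set of three-period orbits, i.e. of the points $p$ for which $T^3(p)$ is defined and $T^3(p)=p$. Then the Hausdorff dimension of $P^3$ is at most one; that is, $\mathcal H^s(P^3)=0$ for every $s>1$, where $\mathcal H^s$ is the $s$-dimensional Hausdorff measure. -/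

import Mathlib

open Set Filter Topology MeasureTheory

/-- A planar billiard table whose boundary is a simple closed curve of class `C³`, the plane being
identified with `ℂ`: a bounded domain together with the natural (arc length) parametrization of
its boundary, traversed so that the domain lies on the left. Convexity is not required. -/
structure BilliardTable where
  /-- the open region enclosed by the boundary -/
  domain : Set ℂ
  /-- the length of the boundary -/
  length : ℝ
  /-- the boundary curve as a function of the natural parameter -/
  γ : ℝ → ℂ
  isOpen_domain : IsOpen domain
  isConnected_domain : IsConnected domain
  isBounded_domain : Bornology.IsBounded domain
  length_pos : 0 < length
  contDiff_γ : ContDiff ℝ 3 γ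
  norm_deriv_γ : ∀ t, ‖deriv γ t‖ = 1
  periodic_γ : Function.Periodic γ length
  simple_γ : ∀ s t : ℝ, γ s = γ t → (s : AddCircle length) = (t : AddCircle length)
  range_γ : range γ = frontier domain
  /-- `I * γ'(t)`, the tangent turned by a right angle, points into the domain. -/
  domain_on_left : ∀ t : ℝ, ∀ᶠ ε : ℝ in 𝓝[>] 0, γ t + ε * (Complex.I * deriv γ t) ∈ domain

namespace BilliardTable

variable (B : BilliardTable)

/-- The phase annulus `S¹ × (0, π)`, with `S¹` the circle of the same length as the boundary. -/
abbrev Phase : Type := AddCircle B.length × Ioo (0 : ℝ) Real.pi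

theorem periodic_deriv_γ : Function.Periodic (deriv B.γ) B.length := by
  intro t
  have h : (fun x => B.γ (x + B.length)) = B.γ := funext B.periodic_γ
  rw [← deriv_comp_add_const, h]

/-- The boundary point with natural parameter `t`. -/
noncomputable def point (t : AddCircle B.length) : ℂ := B.periodic_γ.lift t

/-- The unit tangent vector at the boundary point with natural parameter `t`. -/
noncomputable def tangent (t : AddCircle B.length) : ℂ := B.periodic_deriv_γ.lift t

/-- The outgoing direction encoded by `(t, θ)`: the unit vector that makes the angle `θ` with the
tangent at `t` and points into the domain. -/
noncomputable def outDir (p : B.Phase) : ℂ :=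
  B.tangent p.1 * Complex.exp ((p.2 : ℝ) * Complex.I)

/-- The direction in which the boundary point of `(t, θ)` was reached, if `(t, θ)` describes the
motion just after the collision: the mirror image of the outgoing direction in the tangent
line. -/
noncomputable def inDir (p : B.Phase) : ℂ :=
  B.tangent p.1 * Complex.exp (-((p.2 : ℝ) * Complex.I))

/-- The ball that leaves the boundary according to `p` moves along a straight segment inside the
closed table, next collides with the boundary at the point of `q`, transversally, and is reflected
there by the law of equal angles into the outgoing direction of `q`. Transversality at both ends
is part of the definition of the phase annulus. At a point of the boundary in between, the
segment may only touch the boundary tangentially. -/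
def Collides (p q : B.Phase) : Prop :=
  ∃ r : ℝ, 0 < r ∧
    B.point q.1 = B.point p.1 + r * B.outDir p ∧
    (∀ x : ℝ, 0 < x → x < r → B.point p.1 + x * B.outDir p ∈ closure B.domain) ∧
    (∀ (x : ℝ) (s : AddCircle B.length), 0 < x → x < r →
      B.point s = B.point p.1 + x * B.outDir p →
        B.outDir p = B.tangent s ∨ B.outDir p = -B.tangent s) ∧
    B.inDir q = B.outDir p

theorem point_injective : Function.Injective B.point := by
  intro a b
  induction a using QuotientAddGroup.induction_on with | H s => ?_
  induction b using QuotientAddGroup.induction_on with | H t => ?_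
  exact fun h => B.simple_γ s t h

theorem tangent_ne_zero (t : AddCircle B.length) : B.tangent t ≠ 0 := by
  induction t using QuotientAddGroup.induction_on with | H s => ?_
  have h := B.norm_deriv_γ s
  have h2 : B.tangent ((s : ℝ) : AddCircle B.length) = deriv B.γ s := rfl
  intro h0
  have h3 : deriv B.γ s = 0 := h2 ▸ h0
  rw [h3] at h
  simp at h

theorem exp_neg_injOn {a b : ℝ} (ha : a ∈ Ioo 0 Real.pi) (hb : b ∈ Ioo 0 Real.pi)
    (h : Complex.exp (-(a * Complex.I)) = Complex.exp (-(b * Complex.I))) : a = b := by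
  have h1 := congrArg Complex.re h
  rw [← neg_mul, ← neg_mul, ← Complex.ofReal_neg, ← Complex.ofReal_neg,
    Complex.exp_ofReal_mul_I_re, Complex.exp_ofReal_mul_I_re, Real.cos_neg, Real.cos_neg] at h1
  exact Real.injOn_cos ⟨ha.1.le, ha.2.le⟩ ⟨hb.1.le, hb.2.le⟩ h1

/-- An intermediate contact of a segment cannot be one at which the ball is reflected. -/
theorem inDir_not_tangent (p : B.Phase) : ¬ (B.inDir p = B.tangent p.1 ∨
    B.inDir p = -B.tangent p.1) := by
  have h0 := B.tangent_ne_zero p.1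
  have hs : 0 < Real.sin (p.2 : ℝ) := Real.sin_pos_of_pos_of_lt_pi p.2.2.1 p.2.2.2
  have key : (Complex.exp (-((p.2 : ℝ) * Complex.I))).im ≠ 0 := by
    rw [← neg_mul, ← Complex.ofReal_neg, Complex.exp_ofReal_mul_I_im, Real.sin_neg]
    linarith
  rintro (h | h)
  · apply key
    have : Complex.exp (-((p.2 : ℝ) * Complex.I)) = 1 :=
      mul_left_cancel₀ h0 (by rw [mul_one]; exact h)
    rw [this]; simp
  · apply key
    have : Complex.exp (-((p.2 : ℝ) * Complex.I)) = -1 :=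
      mul_left_cancel₀ h0 (by rw [mul_neg, mul_one]; exact h)
    rw [this]; simp

/-- The next collision is unique, so `Collides` is the graph of a partial map. -/
theorem Collides.unique {p q q' : B.Phase} (h : B.Collides p q) (h' : B.Collides p q') :
    q = q' := by
  obtain ⟨r, hr, h1, -, h3, h4⟩ := h
  obtain ⟨r', hr', h1', -, h3', h4'⟩ := h'
  have hrr : r = r' := by
    rcases lt_trichotomy r r' with hlt | heq | hgt
    · exact absurd (h4 ▸ h3' r q.1 hr hlt h1) (B.inDir_not_tangent q)
    · exact heq
    · exact absurd (h4' ▸ h3 r' q'.1 hr' hgt h1') (B.inDir_not_tangent q')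
  subst hrr
  have ht : q.1 = q'.1 := B.point_injective (h1.trans h1'.symm)
  have he : B.tangent q.1 * Complex.exp (-((q.2 : ℝ) * Complex.I)) =
      B.tangent q.1 * Complex.exp (-((q'.2 : ℝ) * Complex.I)) := by
    have := h4.trans h4'.symm
    unfold inDir at this
    rw [this, ht]
  exact Prod.ext ht (Subtype.ext (exp_neg_injOn q.2.2 q'.2.2
    (mul_left_cancel₀ (B.tangent_ne_zero q.1) he)))

/-- The billiard map `T`, a partial map of the phase annulus to itself, defined at those `p` whose
segment of trajectory ends in a transversal collision with the boundary. -/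
noncomputable def T : B.Phase →. B.Phase :=
  fun p => ⟨∃ q, B.Collides p q, fun h => h.choose⟩

theorem mem_T {p q : B.Phase} : q ∈ B.T p ↔ B.Collides p q :=
  ⟨fun ⟨h, hq⟩ => hq ▸ h.choose_spec,
    fun h => ⟨⟨q, h⟩, Collides.unique B (Exists.choose_spec (p := B.Collides p) ⟨q, h⟩) h⟩⟩

/-- The set of three-period orbits: the points `p` of the phase annulus for which `T³(p)` is
defined and equals `p`. (As `T` has no fixed points, their least period is three.) -/
def P3 : Set B.Phase := {p | p ∈ (B.T.comp (B.T.comp B.T)) p}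

end BilliardTable

/-! A period-three point is recovered from the parameters (t₁, t₂, t₃) of the vertices of its
triangle by a locally Lipschitz map, which cannot raise dimension. So it suffices to bound the set
of such triples in ℝ³ (`dimH_reflectedTriangles_le_one`).

Equal angles at the first and third vertices are two C¹ equations G₁ = G₃ = 0. Where their
differentials are independent, the triples lie locally on a curve; independence can fail only if
2κ₁bc = (b + c − a) sin θ₁, with κ₁ the curvature at the first vertex. For a C³ boundary κ is C¹, so
this exceptional condition is itself a C¹ equation K = 0. On the exceptional set G₁ and K are always
independent: with t₁ fixed, their Jacobian is, up to a nonzero factor, sin θ₂ sin θ₃ cos θ₁ (b + c −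
a), and this is nonzero because the triangle is nondegenerate (`variation_ne_zero`). Both pieces
then have dimension at most one by `dimH_le_one_of_strictFDeriv`. -/

/-! ### Dimension of zero sets -/

/-- A set on which a strictly differentiable function vanishes, such that its derivative is
injective on the kernel of some linear functional, has Hausdorff dimension at most one. -/
theorem dimH_le_one_of_strictFDeriv {E F : Type*} [NormedAddCommGroup E] [NormedSpace ℝ E]
    [FiniteDimensional ℝ E] [NormedAddCommGroup F] [NormedSpace ℝ F] {S : Set E}
    (h : ∀ x ∈ S, ∃ (f : E → F) (f' : E →L[ℝ] F) (l : E →L[ℝ] ℝ), HasStrictFDerivAt f f' x ∧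
      (∀ y ∈ S, f y = 0) ∧ ∀ w, f' w = 0 → l w = 0 → w = 0) :
    dimH S ≤ 1 := by
  have : ProperSpace E := FiniteDimensional.proper_real E
  by_contra! hS
  -- Dimension is local: at some point of `S` every neighbourhood within `S` has dimension above
  -- one. Near that point `l` will turn out to be antilipschitz on `S`.
  obtain ⟨x, hx, hlt⟩ := exists_mem_nhdsWithin_lt_dimH_of_lt_dimH hS
  obtain ⟨f, f', l, hf, hf0, hinj⟩ := h x hx
  have hker : LinearMap.ker (f'.prod l : E →L[ℝ] F × ℝ).toLinearMap = ⊥ := by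
    refine LinearMap.ker_eq_bot'.2 fun w hw => ?_
    have hw' : (f' w, l w) = (0 : F × ℝ) := hw
    exact hinj w (congrArg Prod.fst hw') (congrArg Prod.snd hw')
  obtain ⟨K, hK, hanti⟩ := LinearMap.exists_antilipschitzWith _ hker
  have hKpos : (0 : ℝ) < K := by exact_mod_cast hK
  -- With this bound the linearization error, multiplied by the antilipschitz constant `K` of `(f',
  -- l)`, is half of `‖y - z‖` and can be absorbed.
  have hε : (0 : ℝ) < 1 / (2 * K) := by positivity
  have hev := (hasStrictFDerivAt_iff_isLittleO.1 hf).def hε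
  rw [nhds_prod_eq] at hev
  obtain ⟨U, hU, hUU⟩ := (Filter.eventually_prod_self_iff
    (r := fun y z => ‖f y - f z - f' (y - z)‖ ≤ 1 / (2 * K) * ‖y - z‖)).1 hev
  have key : ∀ y ∈ U ∩ S, ∀ z ∈ U ∩ S, ‖y - z‖ ≤ 2 * K * ‖l y - l z‖ := by
    intro y hy z hz
    have h1 := hUU y hy.1 z hz.1
    simp only [hf0 y hy.2, hf0 z hz.2, sub_zero, zero_sub, norm_neg] at h1
    have h2 : ‖y - z‖ ≤ K * ‖(f' (y - z), l (y - z))‖ := by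
      simpa [dist_eq_norm, ← map_sub] using hanti.le_mul_dist y z
    rw [Prod.norm_def, ← map_sub] at *
    rcases le_total ‖f' (y - z)‖ ‖l (y - z)‖ with hle | hle
    · rw [max_eq_right hle] at h2
      nlinarith [norm_nonneg (l (y - z))]
    · rw [max_eq_left hle] at h2
      have h3 : K * ‖f' (y - z)‖ ≤ K * (1 / (2 * K) * ‖y - z‖) := by gcongr
      have h4 : K * (1 / (2 * K) * ‖y - z‖) = ‖y - z‖ / 2 := by field_simp
      have h5 : ‖y - z‖ ≤ 0 := by linarith
      have := norm_nonneg (l (y - z))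
      nlinarith
  refine absurd (hlt (U ∩ S) (inter_comm S U ▸ inter_mem_nhdsWithin S hU)) (not_lt.2 ?_)
  have hanti' : AntilipschitzWith (2 * K) (fun y : ↥(U ∩ S) => l y) := by
    refine AntilipschitzWith.of_le_mul_dist fun y z => ?_
    simpa [dist_eq_norm, Subtype.dist_eq] using key y y.2 z z.2
  calc dimH (U ∩ S) = dimH (univ : Set ↥(U ∩ S)) := by
        rw [← (isometry_subtype_coe (s := U ∩ S)).dimH_image, image_univ, Subtype.range_coe]
    _ ≤ dimH ((fun y : ↥(U ∩ S) => l y) '' univ) := hanti'.le_dimH_image _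
    _ ≤ dimH (univ : Set ℝ) := dimH_mono (subset_univ _)
    _ = 1 := Real.dimH_univ

/-! ### Calculus of unit speed plane curves -/

/-- The derivative of the norm of a planar curve, in terms of its direction. -/
theorem HasDerivAt.norm_of_eq_smul_unit {z : ℝ → ℂ} {z' e : ℂ} {s r : ℝ} (hz : HasDerivAt z z' s)
    (hr : 0 < r) (he : ‖e‖ = 1) (h : z s = r * e) :
    HasDerivAt (fun x => ‖z x‖) ((starRingEnd ℂ e * z').re) s := by
  have hn : ‖z s‖ = r := by simp [h, he, abs_of_pos hr]
  have h1 := (hz.norm_sq.sqrt (by simp [hn, hr.ne']))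
  simp only [Real.sqrt_sq (norm_nonneg _)] at h1
  convert h1 using 1
  rw [hn, h, Complex.inner]
  simp only [map_mul, Complex.conj_ofReal]
  simp only [Complex.mul_re, Complex.mul_im, Complex.conj_re, Complex.conj_im, Complex.ofReal_re,
    Complex.ofReal_im]
  field_simp
  ring

theorem HasDerivAt.complex_conj {z : ℝ → ℂ} {z' : ℂ} {s : ℝ} (hz : HasDerivAt z z' s) :
    HasDerivAt (fun x => starRingEnd ℂ (z x)) (starRingEnd ℂ z') s :=
  Complex.conjCLE.toContinuousLinearMap.hasFDerivAt.comp_hasDerivAt s hz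

theorem HasDerivAt.comp_line {f : ℝ → ℂ} {f' : ℂ} {p : ℝ} (hf : HasDerivAt f f' p) (dp : ℝ) :
    HasDerivAt (fun s : ℝ => f (p + s * dp)) (dp * f') 0 := by
  have h0 : HasDerivAt f f' (p + 0 * dp) := by simpa using hf
  have line : HasDerivAt (fun s : ℝ => p + s * dp) dp 0 := by
    simpa using ((hasDerivAt_id (0 : ℝ)).mul_const dp).const_add p
  simpa [Function.comp_def] using h0.scomp (0 : ℝ) line

/-- The signed curvature of a unit speed planar curve. -/
noncomputable def signedCurvature (γ : ℝ → ℂ) (t : ℝ) : ℝ :=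
  (deriv (deriv γ) t * starRingEnd ℂ (deriv γ t)).im

theorem Complex.mul_conj_eq_one_of_norm {z : ℂ} (h : ‖z‖ = 1) : z * starRingEnd ℂ z = 1 := by
  rw [Complex.mul_conj', h]; simp

/-- Frenet's equation: differentiating γ' · conj γ' = 1 shows that γ'' · conj γ' is purely
imaginary. -/
theorem hasDerivAt_deriv_of_unit_speed {γ : ℝ → ℂ} (hγ : ContDiff ℝ 3 γ)
    (hu : ∀ t, ‖deriv γ t‖ = 1) (t : ℝ) :
    HasDerivAt (deriv γ) (signedCurvature γ t * Complex.I * deriv γ t) t := by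
  have hd : ContDiff ℝ 2 (deriv γ) := hγ.deriv'
  have h1 : HasDerivAt (deriv γ) (deriv (deriv γ) t) t :=
    (hd.differentiable (by norm_num) t).hasDerivAt
  have h2 : HasDerivAt (fun x => deriv γ x * starRingEnd ℂ (deriv γ x)) _ t :=
    h1.mul h1.complex_conj
  have h3 : (fun x => deriv γ x * starRingEnd ℂ (deriv γ x)) = fun _ => 1 :=
    funext fun x => Complex.mul_conj_eq_one_of_norm (hu x)
  rw [h3] at h2
  have h4 := h2.unique (hasDerivAt_const t (1 : ℂ))
  have h5 := Complex.mul_conj_eq_one_of_norm (hu t)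
  have h6 : deriv (deriv γ) t * starRingEnd ℂ (deriv γ t) = signedCurvature γ t * Complex.I := by
    apply Complex.ext
    · have := congrArg Complex.re h4
      simp at this ⊢
      linarith
    · simp [signedCurvature]
  rw [← h6, mul_assoc, mul_comm (starRingEnd ℂ _), h5, mul_one]
  exact h1

theorem contDiff_signedCurvature {γ : ℝ → ℂ} (hγ : ContDiff ℝ 3 γ) :
    ContDiff ℝ 1 (signedCurvature γ) := by
  have hd : ContDiff ℝ 2 (deriv γ) := hγ.deriv'
  have hdd : ContDiff ℝ 1 (deriv (deriv γ)) := hd.deriv'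
  exact Complex.imCLM.contDiff.comp
    (hdd.mul (Complex.conjCLE.contDiff.comp (hd.of_le (by norm_num))))

/-! ### The law of equal angles and its variation -/

/-- Vanishes if the chord from `γ w` to `γ u` is reflected at `γ u` into the chord from `γ u` to
`γ v`. -/
noncomputable def reflectionDefect (γ : ℝ → ℂ) (u v w : ℝ) : ℝ :=
  ((γ v - γ u) * (γ u - γ w) * starRingEnd ℂ (deriv γ u) ^ 2).im

theorem contDiff_reflectionDefect {γ : ℝ → ℂ} (hγ : ContDiff ℝ 3 γ) {E : Type*}
    [NormedAddCommGroup E] [NormedSpace ℝ E] {u v w : E → ℝ} (hu : ContDiff ℝ 1 u)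
    (hv : ContDiff ℝ 1 v) (hw : ContDiff ℝ 1 w) :
    ContDiff ℝ 1 (fun x => reflectionDefect γ (u x) (v x) (w x)) := by
  have hd : ContDiff ℝ 2 (deriv γ) := hγ.deriv'
  have hγ1 : ContDiff ℝ 1 γ := hγ.of_le (by norm_num)
  have hd1 : ContDiff ℝ 1 (deriv γ) := hd.of_le (by norm_num)
  exact Complex.imCLM.contDiff.comp ((((hγ1.comp hv).sub (hγ1.comp hu)).mul
    ((hγ1.comp hu).sub (hγ1.comp hw))).mul
    ((Complex.conjCLE.contDiff.comp (hd1.comp hu)).pow 2))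

/-- To first order the defect is r r' times (outgoing angle + incoming angle − twice the tangent
angle). Moving the far ends turns the chords at rates sin θv / r and sin θw / r'; moving `u` turns
both chords, and the tangent at rate κ. -/
theorem hasDerivAt_reflectionDefect {γ : ℝ → ℂ} (hγ : ContDiff ℝ 3 γ)
    (hunit : ∀ t, ‖deriv γ t‖ = 1) {u v w du dv dw θu θv θw r r' : ℝ}
    (hv : γ v - γ u = r * (deriv γ u * Complex.exp (θu * Complex.I)))
    (hv' : deriv γ v = deriv γ u * Complex.exp (θu * Complex.I) * Complex.exp (θv * Complex.I))
    (hw : γ u - γ w = r' * (deriv γ u * Complex.exp (-(θu * Complex.I))))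
    (hw' : deriv γ w =
      deriv γ u * Complex.exp (-(θu * Complex.I)) * Complex.exp (-(θw * Complex.I))) :
    HasDerivAt
      (fun s : ℝ => reflectionDefect γ (u + s * du) (v + s * dv) (w + s * dw))
      (((r + r') * Real.sin θu - 2 * signedCurvature γ u * r * r') * du + r' * Real.sin θv * dv
        + r * Real.sin θw * dw) 0 := by
  have hγd : ∀ p dp : ℝ, HasDerivAt (fun s : ℝ => γ (p + s * dp)) (dp * deriv γ p) 0 :=
    fun p dp => (hγ.differentiable (by norm_num) p).hasDerivAt.comp_line dp
  have hτ := (hasDerivAt_deriv_of_unit_speed hγ hunit u).comp_line du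
  have h1 := (((hγd v dv).sub (hγd u du)).mul ((hγd u du).sub (hγd w dw))).mul
    (hτ.complex_conj.pow 2)
  have h2 := Complex.imCLM.hasFDerivAt.comp_hasDerivAt (0 : ℝ) h1
  refine HasDerivAt.congr_deriv h2 ?_
  simp only [zero_mul, add_zero, Complex.imCLM_apply, Pi.mul_apply, Pi.sub_apply, Pi.pow_apply]
  rw [hv, hw, hv', hw']
  have hτ1 := Complex.mul_conj_eq_one_of_norm (hunit u)
  have hE : Complex.exp (θu * Complex.I) * Complex.exp (-(θu * Complex.I)) = 1 := by
    rw [← Complex.exp_add]; simp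
  -- Conjugates and inverse exponentials become independent letters, tied only by ττ' = 1 and EE' =
  -- 1.
  have key : ∀ (τ τ' E E' E2 E3 κ I : ℂ), τ * τ' = 1 → E * E' = 1 →
      ((dv * (τ * E * E2) - du * τ) * (r' * (τ * E')) + r * (τ * E) *
        (du * τ - dw * (τ * E' * E3))) * τ' ^ 2 + r * (τ * E) * (r' * (τ * E')) *
        (2 * τ' ^ (2 - 1) * (du * (κ * -I * τ'))) =
      r' * dv * E2 - r' * du * E' + r * du * E - r * dw * E3 - 2 * r * r' * κ * du * I := by
    intro τ τ' E E' E2 E3 κ I h h'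
    norm_num
    linear_combination (r' * dv * E2 * (E * E') - r' * du * E' + r * du * E -
      r * dw * E3 * (E * E') - 2 * r * r' * κ * du * I * (E * E')) * (τ * τ' + 1) * h +
      (r' * dv * E2 - r * dw * E3 - 2 * r * r' * κ * du * I) * h'
  have := key (deriv γ u) (starRingEnd ℂ (deriv γ u)) (Complex.exp (θu * Complex.I))
    (Complex.exp (-(θu * Complex.I))) (Complex.exp (θv * Complex.I))
    (Complex.exp (-(θw * Complex.I))) (signedCurvature γ u) Complex.I hτ1 hE
  trans (r' * dv * Complex.exp (θv * Complex.I) - r' * du * Complex.exp (-(θu * Complex.I))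
    + r * du * Complex.exp (θu * Complex.I) - r * dw * Complex.exp (-(θw * Complex.I))
    - 2 * r * r' * signedCurvature γ u * du * Complex.I).im
  · rw [← this]
    simp
  · simp [Complex.exp_im, Complex.exp_re]
    ring

/-! ### Geometry of reflected triangles -/

/-- The unit speed curve `γ` passes through the vertices of a triangle with sides `a`, `b`, `c`,
which is reflected at each vertex `γ tᵢ` according to the law of equal angles, with angle `θᵢ`. -/
structure IsReflectedTriangle (γ : ℝ → ℂ) (t₁ t₂ t₃ θ₁ θ₂ θ₃ a b c : ℝ) : Prop where
  a_pos : 0 < a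
  b_pos : 0 < b
  c_pos : 0 < c
  sin₁_pos : 0 < Real.sin θ₁
  sin₂_pos : 0 < Real.sin θ₂
  sin₃_pos : 0 < Real.sin θ₃
  side₁₂ : γ t₂ - γ t₁ = c * (deriv γ t₁ * Complex.exp (θ₁ * Complex.I))
  side₂₃ : γ t₃ - γ t₂ = a * (deriv γ t₂ * Complex.exp (θ₂ * Complex.I))
  side₃₁ : γ t₁ - γ t₃ = b * (deriv γ t₃ * Complex.exp (θ₃ * Complex.I))
  dir₁₂ : deriv γ t₂ =
    deriv γ t₁ * Complex.exp (θ₁ * Complex.I) * Complex.exp (θ₂ * Complex.I)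
  dir₂₃ : deriv γ t₃ =
    deriv γ t₂ * Complex.exp (θ₂ * Complex.I) * Complex.exp (θ₃ * Complex.I)
  dir₃₁ : deriv γ t₁ =
    deriv γ t₃ * Complex.exp (θ₃ * Complex.I) * Complex.exp (θ₁ * Complex.I)

/-- On a reflected triangle, vanishes if the curvature at the first vertex is the one for which the
second derivative of the perimeter has rank one there. -/
noncomputable def curvatureDefect (γ : ℝ → ℂ) (u v w : ℝ) : ℝ :=
  (starRingEnd ℂ (deriv γ u) * (γ v - γ u)).im *
    (‖γ u - γ w‖ + ‖γ v - γ u‖ - ‖γ w - γ v‖) -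
  2 * signedCurvature γ u * (‖γ u - γ w‖ * ‖γ v - γ u‖ ^ 2)

theorem Complex.exp_mul_I_mul_exp_neg (θ : ℝ) :
    Complex.exp (θ * Complex.I) * Complex.exp (-(θ * Complex.I)) = 1 := by
  rw [← Complex.exp_add, add_neg_cancel, Complex.exp_zero]

namespace IsReflectedTriangle

variable {γ : ℝ → ℂ} {t₁ t₂ t₃ θ₁ θ₂ θ₃ a b c : ℝ}

theorem rotate (h : IsReflectedTriangle γ t₁ t₂ t₃ θ₁ θ₂ θ₃ a b c) :
    IsReflectedTriangle γ t₃ t₁ t₂ θ₃ θ₁ θ₂ c a b :=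
  ⟨h.c_pos, h.a_pos, h.b_pos, h.sin₃_pos, h.sin₁_pos, h.sin₂_pos, h.side₃₁, h.side₁₂, h.side₂₃,
    h.dir₃₁, h.dir₁₂, h.dir₂₃⟩

theorem side₃₁' (h : IsReflectedTriangle γ t₁ t₂ t₃ θ₁ θ₂ θ₃ a b c) :
    γ t₁ - γ t₃ = b * (deriv γ t₁ * Complex.exp (-(θ₁ * Complex.I))) := by
  have := Complex.exp_mul_I_mul_exp_neg θ₁
  rw [h.side₃₁, h.dir₃₁]
  linear_combination -(b * deriv γ t₃ * Complex.exp (θ₃ * Complex.I)) * this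

theorem dir₁₃ (h : IsReflectedTriangle γ t₁ t₂ t₃ θ₁ θ₂ θ₃ a b c) :
    deriv γ t₃ =
      deriv γ t₁ * Complex.exp (-(θ₁ * Complex.I)) * Complex.exp (-(θ₃ * Complex.I)) := by
  have h1 := Complex.exp_mul_I_mul_exp_neg θ₁
  have h3 := Complex.exp_mul_I_mul_exp_neg θ₃
  rw [h.dir₃₁]
  linear_combination -(deriv γ t₃) * h3 - deriv γ t₃ * Complex.exp (θ₃ * Complex.I) *
    Complex.exp (-(θ₃ * Complex.I)) * h1

theorem norm_side₁₂ (h : IsReflectedTriangle γ t₁ t₂ t₃ θ₁ θ₂ θ₃ a b c)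
    (hu : ∀ t, ‖deriv γ t‖ = 1) : ‖γ t₂ - γ t₁‖ = c := by
  rw [h.side₁₂]
  simp [hu, Complex.norm_exp_ofReal_mul_I, abs_of_pos h.c_pos]

theorem reflectionDefect_eq_zero (h : IsReflectedTriangle γ t₁ t₂ t₃ θ₁ θ₂ θ₃ a b c)
    (hu : ∀ t, ‖deriv γ t‖ = 1) : reflectionDefect γ t₁ t₂ t₃ = 0 := by
  have h1 := Complex.exp_mul_I_mul_exp_neg θ₁
  have h2 := Complex.mul_conj_eq_one_of_norm (hu t₁)
  have key : (γ t₂ - γ t₁) * (γ t₁ - γ t₃) * starRingEnd ℂ (deriv γ t₁) ^ 2 =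
      ((c * b : ℝ) : ℂ) := by
    rw [h.side₁₂, h.side₃₁']
    push_cast
    linear_combination (c * b * (deriv γ t₁) ^ 2 * starRingEnd ℂ (deriv γ t₁) ^ 2) * h1 +
      c * b * (deriv γ t₁ * starRingEnd ℂ (deriv γ t₁) + 1) * h2
  rw [reflectionDefect, key, Complex.ofReal_im]

theorem conj_mul_side (h : IsReflectedTriangle γ t₁ t₂ t₃ θ₁ θ₂ θ₃ a b c)
    (hu : ∀ t, ‖deriv γ t‖ = 1) :
    (starRingEnd ℂ (deriv γ t₁) * (γ t₂ - γ t₁)) = c * Complex.exp (θ₁ * Complex.I) := by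
  rw [h.side₁₂]
  linear_combination c * Complex.exp (θ₁ * Complex.I) * Complex.mul_conj_eq_one_of_norm (hu t₁)

/-- The defect uses Im(conj γ'(t₁) · (γ t₂ − γ t₁)) = c sin θ₁ in place of the sine, hence the
harmless positive factor `c`. -/
theorem curvatureDefect_eq (h : IsReflectedTriangle γ t₁ t₂ t₃ θ₁ θ₂ θ₃ a b c)
    (hu : ∀ t, ‖deriv γ t‖ = 1) :
    curvatureDefect γ t₁ t₂ t₃ =
      c * (Real.sin θ₁ * (b + c - a) - 2 * signedCurvature γ t₁ * b * c) := by
  rw [curvatureDefect, h.conj_mul_side hu, h.norm_side₁₂ hu, h.rotate.norm_side₁₂ hu,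
    h.rotate.rotate.norm_side₁₂ hu, Complex.im_ofReal_mul,
    Complex.exp_ofReal_mul_I_im]
  ring

/-- The sines and cosines of the angles determine the sides of the triangle up to similarity. -/
theorem exists_trig (h : IsReflectedTriangle γ t₁ t₂ t₃ θ₁ θ₂ θ₃ a b c)
    (hu : ∀ t, ‖deriv γ t‖ = 1) :
    ∃ δ ρ : ℝ, δ ^ 2 = 1 ∧ ρ ≠ 0 ∧
      Real.sin θ₃ = -δ * (Real.sin θ₁ * Real.cos θ₂ + Real.cos θ₁ * Real.sin θ₂) ∧
      Real.cos θ₃ = δ * (Real.cos θ₁ * Real.cos θ₂ - Real.sin θ₁ * Real.sin θ₂) ∧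
      a = ρ * (Real.sin θ₁ * Real.cos θ₁) ∧ b = ρ * (Real.sin θ₂ * Real.cos θ₂) ∧
      c = ρ * (Real.sin θ₃ * Real.cos θ₃) := by
  set E₁ := Complex.exp (θ₁ * Complex.I) with hE₁
  set E₂ := Complex.exp (θ₂ * Complex.I) with hE₂
  set E₃ := Complex.exp (θ₃ * Complex.I) with hE₃
  have hτ : deriv γ t₁ ≠ 0 := by
    intro h0
    simpa [h0] using hu t₁
  -- Once around the triangle the tangent turns by 2(θ₁ + θ₂ + θ₃), so this sum of angles is a
  -- multiple of π; the sign `δ` below is E₁E₂E₃.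
  have hsq : (E₁ * E₂ * E₃) ^ 2 = 1 := by
    apply mul_left_cancel₀ hτ
    have h1 := h.dir₁₂
    have h2 := h.dir₂₃
    have h3 := h.dir₃₁
    rw [h2, h1] at h3
    linear_combination -h3
  -- The three sides sum to zero; dividing by the direction of the first leaves turns by 2θ₂ and
  -- −2θ₁. The imaginary part is a law of sines.
  have hclose : c + a * E₂ ^ 2 + b * Complex.exp (-(θ₁ * Complex.I)) ^ 2 = 0 := by
    have hE := Complex.exp_mul_I_mul_exp_neg θ₁
    have h0 : (γ t₂ - γ t₁) + (γ t₃ - γ t₂) + (γ t₁ - γ t₃) = 0 := by ring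
    rw [h.side₁₂, h.side₂₃, h.side₃₁', h.dir₁₂] at h0
    have hne : deriv γ t₁ * E₁ ≠ 0 := mul_ne_zero hτ (Complex.exp_ne_zero _)
    apply mul_left_cancel₀ hne
    linear_combination h0 + deriv γ t₁ * b * Complex.exp (-(θ₁ * Complex.I)) * hE
  obtain ⟨δ, hδ, hprod⟩ : ∃ δ : ℝ, δ ^ 2 = 1 ∧ E₁ * E₂ = δ * Complex.exp (-(θ₃ * Complex.I)) := by
    have hE := Complex.exp_mul_I_mul_exp_neg θ₃
    have h0 : (E₁ * E₂ * E₃ - 1) * (E₁ * E₂ * E₃ + 1) = 0 := by linear_combination hsq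
    rcases mul_eq_zero.1 h0 with h1 | h1
    · refine ⟨1, by norm_num, ?_⟩
      push_cast
      linear_combination Complex.exp (-(θ₃ * Complex.I)) * h1 - E₁ * E₂ * hE
    · refine ⟨-1, by norm_num, ?_⟩
      push_cast
      linear_combination Complex.exp (-(θ₃ * Complex.I)) * h1 - E₁ * E₂ * hE
  have him := congrArg Complex.im hprod
  have hre := congrArg Complex.re hprod
  have hcre := congrArg Complex.re hclose
  have hcim := congrArg Complex.im hclose
  simp [hE₁, hE₂, Complex.exp_re, Complex.exp_im, sq] at him hre hcre hcim
  have hs₃ : Real.sin θ₃ = -δ * (Real.sin θ₁ * Real.cos θ₂ + Real.cos θ₁ * Real.sin θ₂) := by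
    linear_combination δ * him - Real.sin θ₃ * hδ
  have hc₃ : Real.cos θ₃ = δ * (Real.cos θ₁ * Real.cos θ₂ - Real.sin θ₁ * Real.sin θ₂) := by
    linear_combination -δ * hre - Real.cos θ₃ * hδ
  -- A right angle θ₁ would send the ball straight back; θ₂ would be right too, forcing sin θ₃ = 0.
  have hc₁0 : Real.cos θ₁ ≠ 0 := by
    intro h1
    have h2 : Real.cos θ₂ = 0 := by
      have : a * Real.sin θ₂ * Real.cos θ₂ = 0 := by rw [h1] at hcim; linarith
      exact (mul_eq_zero.1 this).resolve_left (mul_pos h.a_pos h.sin₂_pos).ne'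
    have h3 := h.sin₃_pos
    rw [hs₃, h1, h2] at h3
    simp at h3
  have hs₁0 := h.sin₁_pos.ne'
  have ha : a = a / (Real.sin θ₁ * Real.cos θ₁) * (Real.sin θ₁ * Real.cos θ₁) := by field_simp
  have hb : b = a / (Real.sin θ₁ * Real.cos θ₁) * (Real.sin θ₂ * Real.cos θ₂) := by
    field_simp
    linarith
  -- Since a = (ρ/2) sin 2θ₁, |ρ|/2 is the circumdiameter.
  refine ⟨δ, a / (Real.sin θ₁ * Real.cos θ₁), hδ,
    div_ne_zero h.a_pos.ne' (mul_ne_zero hs₁0 hc₁0), hs₃, hc₃, ha, hb, ?_⟩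
  set ρ := a / (Real.sin θ₁ * Real.cos θ₁)
  rw [hs₃, hc₃]
  rw [ha, hb] at hcre
  linear_combination hcre + ρ * (Real.sin θ₁ * Real.cos θ₂ + Real.cos θ₁ * Real.sin θ₂) *
    (Real.cos θ₁ * Real.cos θ₂ - Real.sin θ₁ * Real.sin θ₂) * hδ

end IsReflectedTriangle

/-! ### Variation of the curvature condition -/

namespace IsReflectedTriangle

variable {γ : ℝ → ℂ} {t₁ t₂ t₃ θ₁ θ₂ θ₃ a b c : ℝ}

/-- Up to the factor −c, this is the Jacobian of (G₁, K) in (t₂, t₃) once κ is eliminated through K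
= 0. It collapses to 3 sin θ₂ sin θ₃ cos θ₁ (b + c − a). -/
theorem variation_ne_zero (h : IsReflectedTriangle γ t₁ t₂ t₃ θ₁ θ₂ θ₃ a b c)
    (hu : ∀ t, ‖deriv γ t‖ = 1) :
    (Real.sin θ₁ * Real.cos θ₂ + Real.cos θ₁ * Real.sin θ₂) * Real.sin θ₃ * (b + c - a) +
      2 * Real.sin θ₁ * (Real.cos θ₂ * Real.sin θ₃ * c + Real.cos θ₃ * Real.sin θ₂ * b) -
      Real.sin θ₁ * (b + c - a) * (Real.cos θ₃ * Real.sin θ₂ + 2 * Real.cos θ₂ * Real.sin θ₃)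
      ≠ 0 := by
  obtain ⟨δ, ρ, hδ, hρ, hs, hc, ha, hb, hc'⟩ := h.exists_trig hu
  have hs₁0 := h.sin₁_pos.ne'
  have hs₂0 := h.sin₂_pos.ne'
  have hs₃0 := h.sin₃_pos.ne'
  have hc₁0 : Real.cos θ₁ ≠ 0 := fun h0 => h.a_pos.ne' (by rw [ha, h0]; ring)
  have hc₂0 : Real.cos θ₂ ≠ 0 := fun h0 => h.b_pos.ne' (by rw [hb, h0]; ring)
  have hc₃0 : Real.cos θ₃ ≠ 0 := fun h0 => h.c_pos.ne' (by rw [hc', h0]; ring)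
  have hδ0 : δ ≠ 0 := fun h0 => by simp [h0] at hδ
  have h2 := Real.sin_sq_add_cos_sq θ₂
  have h3 := Real.sin_sq_add_cos_sq θ₃
  clear h
  generalize Real.sin θ₁ = s₁, Real.cos θ₁ = c₁, Real.sin θ₂ = s₂, Real.cos θ₂ = c₂,
    Real.sin θ₃ = s₃, Real.cos θ₃ = c₃ at *
  have hs₁ : s₁ = -δ * (s₂ * c₃ + c₂ * s₃) := by
    rw [hs, hc]
    linear_combination -(s₁ * (s₂ ^ 2 + c₂ ^ 2)) * hδ - s₁ * h2
  have hc₁ : c₁ = δ * (c₂ * c₃ - s₂ * s₃) := by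
    rw [hs, hc]
    linear_combination -(c₁ * (s₂ ^ 2 + c₂ ^ 2)) * hδ - c₁ * h2
  have hS : s₁ * c₂ + c₁ * s₂ = -δ * s₃ := by
    linear_combination δ * hs - (s₁ * c₂ + c₁ * s₂) * hδ
  -- The strict triangle inequality in factored form; no factor vanishes.
  have hP : b + c - a = -2 * δ * ρ * s₁ * c₂ * c₃ := by
    rw [ha, hb, hc', hs₁, hc₁]
    linear_combination ρ * (s₂ * c₃ + c₂ * s₃) * (-(c₂ * c₃) - s₂ * s₃) * hδ -
      ρ * s₂ * c₂ * h3 - ρ * s₃ * c₃ * h2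
  have hN : (s₁ * c₂ + c₁ * s₂) * s₃ * (b + c - a) +
      2 * s₁ * (c₂ * s₃ * c + c₃ * s₂ * b) -
      s₁ * (b + c - a) * (c₃ * s₂ + 2 * c₂ * s₃) = 3 * s₂ * s₃ * c₁ * (b + c - a) := by
    have h4 : 2 * s₁ * (c₂ * s₃ * c + c₃ * s₂ * b) = -δ * (b + c - a) * (s₂ ^ 2 + s₃ ^ 2) := by
      rw [hP, hb, hc']
      linear_combination -2 * ρ * s₁ * c₂ * c₃ * (s₂ ^ 2 + s₃ ^ 2) * hδ
    have h5 : -δ * s₃ ^ 2 - δ * (s₂ ^ 2 + s₃ ^ 2) - s₁ * (c₃ * s₂ + 2 * c₂ * s₃) =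
        3 * s₂ * s₃ * c₁ := by
      rw [hs₁, hc₁]
      linear_combination δ * s₂ ^ 2 * h3 + 2 * δ * s₃ ^ 2 * h2
    rw [hS, h4]
    linear_combination (b + c - a) * h5
  rw [hN, hP]
  have h22 : (-2 : ℝ) ≠ 0 := by norm_num
  positivity

/-- The first vertex stays fixed, so the derivative of the curvature never appears. -/
theorem hasDerivAt_curvatureDefect (h : IsReflectedTriangle γ t₁ t₂ t₃ θ₁ θ₂ θ₃ a b c)
    (hγ : ContDiff ℝ 3 γ) (hu : ∀ t, ‖deriv γ t‖ = 1) (dv dw : ℝ) :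
    HasDerivAt (fun s : ℝ => curvatureDefect γ t₁ (t₂ + s * dv) (t₃ + s * dw))
      ((Real.sin θ₁ * Real.cos θ₂ + Real.cos θ₁ * Real.sin θ₂) * dv * (b + c - a) +
        Real.sin θ₁ * c * (2 * Real.cos θ₂ * dv - 2 * Real.cos θ₃ * dw) -
        2 * signedCurvature γ t₁ *
          (-(Real.cos θ₃ * dw) * c ^ 2 + 2 * b * c * (Real.cos θ₂ * dv))) 0 := by
  have hγd : ∀ p dp : ℝ, HasDerivAt (fun s : ℝ => γ (p + s * dp)) (dp * deriv γ p) 0 :=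
    fun p dp => (hγ.differentiable (by norm_num) p).hasDerivAt.comp_line dp
  have hv := hγd t₂ dv
  have hw := hγd t₃ dw
  have hnorm : ∀ t θ : ℝ, ‖deriv γ t * Complex.exp (θ * Complex.I)‖ = 1 := fun t θ => by
    rw [norm_mul, hu, Complex.norm_exp_ofReal_mul_I, one_mul]
  have conj_exp : ∀ θ : ℝ, starRingEnd ℂ (Complex.exp (θ * Complex.I)) =
      Complex.exp (-(θ * Complex.I)) := fun θ => by
    rw [← Complex.exp_conj]; simp
  have hc := (hv.sub_const (γ t₁)).norm_of_eq_smul_unit h.c_pos (hnorm t₁ θ₁)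
    (by simpa using h.side₁₂)
  have hb := (hw.const_sub (γ t₁)).norm_of_eq_smul_unit h.b_pos (hnorm t₃ θ₃)
    (by simpa using h.side₃₁)
  have ha := (hw.sub hv).norm_of_eq_smul_unit h.a_pos (hnorm t₂ θ₂)
    (by simpa using h.side₂₃)
  have hi := Complex.imCLM.hasFDerivAt.comp_hasDerivAt (0 : ℝ)
    ((hv.sub_const (γ t₁)).const_mul (starRingEnd ℂ (deriv γ t₁)))
  have hE₁ := Complex.exp_mul_I_mul_exp_neg θ₁
  have hE₂ := Complex.exp_mul_I_mul_exp_neg θ₂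
  have hE₃ := Complex.exp_mul_I_mul_exp_neg θ₃
  have hτ := fun t => Complex.mul_conj_eq_one_of_norm (hu t)
  have hcv : (starRingEnd ℂ (deriv γ t₁ * Complex.exp (θ₁ * Complex.I)) * (dv * deriv γ t₂)).re =
      Real.cos θ₂ * dv := by
    have : starRingEnd ℂ (deriv γ t₁ * Complex.exp (θ₁ * Complex.I)) * (dv * deriv γ t₂) =
        dv * Complex.exp (θ₂ * Complex.I) := by
      rw [map_mul, conj_exp, h.dir₁₂]
      linear_combination dv * Complex.exp (θ₂ * Complex.I) * (hE₁ +
        Complex.exp (θ₁ * Complex.I) * Complex.exp (-(θ₁ * Complex.I)) * hτ t₁)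
    rw [this, Complex.re_ofReal_mul, Complex.exp_ofReal_mul_I_re, mul_comm]
  have hbv : (starRingEnd ℂ (deriv γ t₃ * Complex.exp (θ₃ * Complex.I)) *
      (-(dw * deriv γ t₃))).re = -(Real.cos θ₃ * dw) := by
    have : starRingEnd ℂ (deriv γ t₃ * Complex.exp (θ₃ * Complex.I)) * (-(dw * deriv γ t₃)) =
        (-dw : ℝ) * Complex.exp (-(θ₃ * Complex.I)) := by
      rw [map_mul, conj_exp]
      push_cast
      linear_combination -dw * Complex.exp (-(θ₃ * Complex.I)) * hτ t₃
    rw [this, Complex.re_ofReal_mul, ← conj_exp, Complex.conj_re, Complex.exp_ofReal_mul_I_re]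
    ring
  have hav : (starRingEnd ℂ (deriv γ t₂ * Complex.exp (θ₂ * Complex.I)) *
      (dw * deriv γ t₃ - dv * deriv γ t₂)).re = Real.cos θ₃ * dw - Real.cos θ₂ * dv := by
    have : starRingEnd ℂ (deriv γ t₂ * Complex.exp (θ₂ * Complex.I)) *
        (dw * deriv γ t₃ - dv * deriv γ t₂) =
        dw * Complex.exp (θ₃ * Complex.I) - dv * Complex.exp (-(θ₂ * Complex.I)) := by
      rw [map_mul, conj_exp, h.dir₂₃]
      linear_combination dw * Complex.exp (θ₃ * Complex.I) * (hE₂ +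
        Complex.exp (θ₂ * Complex.I) * Complex.exp (-(θ₂ * Complex.I)) * hτ t₂) -
        dv * Complex.exp (-(θ₂ * Complex.I)) * hτ t₂
    rw [this, Complex.sub_re, Complex.re_ofReal_mul, Complex.re_ofReal_mul, ← conj_exp,
      Complex.conj_re, Complex.exp_ofReal_mul_I_re, Complex.exp_ofReal_mul_I_re]
    ring
  have hiv : (starRingEnd ℂ (deriv γ t₁) * (dv * deriv γ t₂)).im =
      (Real.sin θ₁ * Real.cos θ₂ + Real.cos θ₁ * Real.sin θ₂) * dv := by
    have : starRingEnd ℂ (deriv γ t₁) * (dv * deriv γ t₂) =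
        dv * Complex.exp ((θ₁ + θ₂ : ℝ) * Complex.I) := by
      rw [h.dir₁₂, Complex.ofReal_add, add_mul, Complex.exp_add]
      linear_combination dv * Complex.exp (θ₁ * Complex.I) * Complex.exp (θ₂ * Complex.I) * hτ t₁
    rw [this, Complex.im_ofReal_mul, Complex.exp_ofReal_mul_I_im, Real.sin_add]
    ring
  rw [hcv] at hc
  rw [hbv] at hb
  rw [hav] at ha
  have hi0 : (starRingEnd ℂ (deriv γ t₁) * (γ t₂ - γ t₁)).im = c * Real.sin θ₁ := by
    rw [h.conj_mul_side hu, Complex.im_ofReal_mul, Complex.exp_ofReal_mul_I_im]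
  have hK := (hi.mul ((hb.add hc).sub ha)).sub
    ((hb.mul (hc.pow 2)).const_mul (2 * signedCurvature γ t₁))
  refine HasDerivAt.congr_deriv hK ?_
  simp only [Function.comp_apply, Pi.add_apply, Pi.sub_apply, Pi.pow_apply, zero_mul,
    add_zero, Complex.imCLM_apply, hiv, hi0, h.norm_side₁₂ hu, h.rotate.norm_side₁₂ hu,
    h.rotate.rotate.norm_side₁₂ hu]
  push_cast
  ring

end IsReflectedTriangle

/-! ### Dimension of the set of reflected triangles -/

/-- The triples of parameters of the vertices of reflected triangles. -/
def reflectedTriangles (γ : ℝ → ℂ) : Set (ℝ × ℝ × ℝ) :=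
  {x | ∃ θ₁ θ₂ θ₃ a b c, IsReflectedTriangle γ x.1 x.2.1 x.2.2 θ₁ θ₂ θ₃ a b c}

theorem HasFDerivAt.hasDerivAt_line {f : ℝ × ℝ × ℝ → ℝ} {f' : ℝ × ℝ × ℝ →L[ℝ] ℝ}
    {x : ℝ × ℝ × ℝ} (hf : HasFDerivAt f f' x) (w : ℝ × ℝ × ℝ) :
    HasDerivAt (fun s : ℝ => f (x.1 + s * w.1, x.2.1 + s * w.2.1, x.2.2 + s * w.2.2)) (f' w) 0 := by
  have h1 : HasDerivAt (fun s : ℝ => x + s • w) w 0 := by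
    simpa using ((hasDerivAt_id (0 : ℝ)).smul_const w).const_add x
  have h2 : HasFDerivAt f f' (x + (0 : ℝ) • w) := by simpa using hf
  exact h2.comp_hasDerivAt (0 : ℝ) h1

namespace IsReflectedTriangle

variable {γ : ℝ → ℂ} {x : ℝ × ℝ × ℝ} {θ₁ θ₂ θ₃ a b c : ℝ}

theorem fderiv_reflectionDefect (h : IsReflectedTriangle γ x.1 x.2.1 x.2.2 θ₁ θ₂ θ₃ a b c)
    (hγ : ContDiff ℝ 3 γ) (hu : ∀ t, ‖deriv γ t‖ = 1) (w : ℝ × ℝ × ℝ) :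
    fderiv ℝ (fun y : ℝ × ℝ × ℝ => reflectionDefect γ y.1 y.2.1 y.2.2) x w =
      ((c + b) * Real.sin θ₁ - 2 * signedCurvature γ x.1 * c * b) * w.1 +
        b * Real.sin θ₂ * w.2.1 + c * Real.sin θ₃ * w.2.2 :=
  have hd : ContDiff ℝ 1 (fun y : ℝ × ℝ × ℝ => reflectionDefect γ y.1 y.2.1 y.2.2) :=
    contDiff_reflectionDefect hγ contDiff_fst (contDiff_fst.comp contDiff_snd)
      (contDiff_snd.comp contDiff_snd)
  ((hd.differentiable one_ne_zero x).hasFDerivAt.hasDerivAt_line w).unique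
    (hasDerivAt_reflectionDefect hγ hu h.side₁₂ h.dir₁₂ h.side₃₁' h.dir₁₃)

theorem fderiv_reflectionDefect_rotate
    (h : IsReflectedTriangle γ x.1 x.2.1 x.2.2 θ₁ θ₂ θ₃ a b c)
    (hγ : ContDiff ℝ 3 γ) (hu : ∀ t, ‖deriv γ t‖ = 1) (w : ℝ × ℝ × ℝ) :
    fderiv ℝ (fun y : ℝ × ℝ × ℝ => reflectionDefect γ y.2.2 y.1 y.2.1) x w =
      ((b + a) * Real.sin θ₃ - 2 * signedCurvature γ x.2.2 * b * a) * w.2.2 +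
        a * Real.sin θ₁ * w.1 + b * Real.sin θ₂ * w.2.1 :=
  have hd : ContDiff ℝ 1 (fun y : ℝ × ℝ × ℝ => reflectionDefect γ y.2.2 y.1 y.2.1) :=
    contDiff_reflectionDefect hγ (contDiff_snd.comp contDiff_snd) contDiff_fst
      (contDiff_fst.comp contDiff_snd)
  ((hd.differentiable one_ne_zero x).hasFDerivAt.hasDerivAt_line w).unique
    (hasDerivAt_reflectionDefect hγ hu h.rotate.side₁₂ h.rotate.dir₁₂ h.rotate.side₃₁'
      h.rotate.dir₁₃)

theorem contDiffAt_curvatureDefect (h : IsReflectedTriangle γ x.1 x.2.1 x.2.2 θ₁ θ₂ θ₃ a b c)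
    (hγ : ContDiff ℝ 3 γ) (hu : ∀ t, ‖deriv γ t‖ = 1) :
    ContDiffAt ℝ 1 (fun y : ℝ × ℝ × ℝ => curvatureDefect γ y.1 y.2.1 y.2.2) x := by
  have hγ1 : ContDiff ℝ 1 γ := hγ.of_le (by norm_num)
  have hd : ContDiff ℝ 2 (deriv γ) := hγ.deriv'
  have hd1 : ContDiff ℝ 1 (deriv γ) := hd.of_le (by norm_num)
  have p₁ : ContDiff ℝ 1 (fun y : ℝ × ℝ × ℝ => y.1) := contDiff_fst
  have p₂ : ContDiff ℝ 1 (fun y : ℝ × ℝ × ℝ => y.2.1) := contDiff_fst.comp contDiff_snd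
  have p₃ : ContDiff ℝ 1 (fun y : ℝ × ℝ × ℝ => y.2.2) := contDiff_snd.comp contDiff_snd
  have hc : ContDiffAt ℝ 1 (fun y : ℝ × ℝ × ℝ => ‖γ y.2.1 - γ y.1‖) x :=
    ((hγ1.comp p₂).sub (hγ1.comp p₁)).contDiffAt.norm ℝ
      (norm_ne_zero_iff.1 (by simpa [h.norm_side₁₂ hu] using h.c_pos.ne'))
  have hb : ContDiffAt ℝ 1 (fun y : ℝ × ℝ × ℝ => ‖γ y.1 - γ y.2.2‖) x :=
    ((hγ1.comp p₁).sub (hγ1.comp p₃)).contDiffAt.norm ℝ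
      (norm_ne_zero_iff.1 (by simpa [h.rotate.norm_side₁₂ hu] using h.b_pos.ne'))
  have ha : ContDiffAt ℝ 1 (fun y : ℝ × ℝ × ℝ => ‖γ y.2.2 - γ y.2.1‖) x :=
    ((hγ1.comp p₃).sub (hγ1.comp p₂)).contDiffAt.norm ℝ
      (norm_ne_zero_iff.1 (by simpa [h.rotate.rotate.norm_side₁₂ hu] using h.a_pos.ne'))
  have hκ := ((contDiff_signedCurvature hγ).comp p₁).contDiffAt (x := x)
  have hi : ContDiffAt ℝ 1
      (fun y : ℝ × ℝ × ℝ => (starRingEnd ℂ (deriv γ y.1) * (γ y.2.1 - γ y.1)).im) x :=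
    (Complex.imCLM.contDiff.comp ((Complex.conjCLE.contDiff.comp (hd1.comp p₁)).mul
      ((hγ1.comp p₂).sub (hγ1.comp p₁)))).contDiffAt
  exact (hi.mul ((hb.add hc).sub ha)).sub ((contDiffAt_const.mul hκ).mul (hb.mul (hc.pow 2)))

end IsReflectedTriangle

theorem dimH_reflectedTriangles_le_one {γ : ℝ → ℂ} (hγ : ContDiff ℝ 3 γ)
    (hu : ∀ t, ‖deriv γ t‖ = 1) : dimH (reflectedTriangles γ) ≤ 1 := by
  set K : ℝ × ℝ × ℝ → ℝ := fun y => curvatureDefect γ y.1 y.2.1 y.2.2 with hK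
  set G₁ : ℝ × ℝ × ℝ → ℝ := fun y => reflectionDefect γ y.1 y.2.1 y.2.2 with hG₁
  set G₃ : ℝ × ℝ × ℝ → ℝ := fun y => reflectionDefect γ y.2.2 y.1 y.2.1 with hG₃
  have hdG₁ : ContDiff ℝ 1 G₁ := contDiff_reflectionDefect hγ contDiff_fst
    (contDiff_fst.comp contDiff_snd) (contDiff_snd.comp contDiff_snd)
  have hdG₃ : ContDiff ℝ 1 G₃ := contDiff_reflectionDefect hγ (contDiff_snd.comp contDiff_snd)
    contDiff_fst (contDiff_fst.comp contDiff_snd)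
  have hsplit : reflectedTriangles γ ⊆ {x ∈ reflectedTriangles γ | K x ≠ 0} ∪
      {x ∈ reflectedTriangles γ | K x = 0} := fun x hx =>
    (em (K x = 0)).elim (fun h => Or.inr ⟨hx, h⟩) (fun h => Or.inl ⟨hx, h⟩)
  refine (dimH_mono hsplit).trans ?_
  rw [dimH_union]
  refine max_le (dimH_le_one_of_strictFDeriv (F := ℝ × ℝ) ?_)
    (dimH_le_one_of_strictFDeriv (F := ℝ × ℝ) ?_)
  · rintro x ⟨⟨θ₁, θ₂, θ₃, a, b, c, h⟩, hKx⟩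
    refine ⟨fun y => (G₁ y, G₃ y), (fderiv ℝ G₁ x).prod (fderiv ℝ G₃ x),
      (ContinuousLinearMap.snd ℝ ℝ ℝ).comp (ContinuousLinearMap.snd ℝ ℝ (ℝ × ℝ)),
      (hdG₁.contDiffAt.hasStrictFDerivAt one_ne_zero).prodMk
        (hdG₃.contDiffAt.hasStrictFDerivAt one_ne_zero), ?_, ?_⟩
    · rintro y ⟨⟨_, _, _, _, _, _, hy⟩, -⟩
      exact Prod.ext (hy.reflectionDefect_eq_zero hu) (hy.rotate.reflectionDefect_eq_zero hu)
    · rintro ⟨w₁, w₂, w₃⟩ hw (rfl : w₃ = 0)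
      have h1 : fderiv ℝ G₁ x (w₁, w₂, 0) = 0 := congrArg Prod.fst hw
      have h3 : fderiv ℝ G₃ x (w₁, w₂, 0) = 0 := congrArg Prod.snd hw
      rw [h.fderiv_reflectionDefect hγ hu] at h1
      rw [h.fderiv_reflectionDefect_rotate hγ hu] at h3
      simp only [mul_zero, add_zero, zero_add] at h1 h3
      have hk : Real.sin θ₁ * (b + c - a) - 2 * signedCurvature γ x.1 * b * c ≠ 0 := fun h0 =>
        hKx (by simp only [hK]; rw [h.curvatureDefect_eq hu, h0, mul_zero])
      have hw₁ : w₁ = 0 := by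
        refine (mul_eq_zero.1 ?_).resolve_left hk
        -- The w₂ terms of the two equations coincide, so subtraction leaves exactly the curvature
        -- condition as coefficient of w₁.
        linear_combination h1 - h3
      have hw₂ : w₂ = 0 := by
        subst hw₁
        refine (mul_eq_zero.1 ?_).resolve_left (mul_pos h.b_pos h.sin₂_pos).ne'
        linear_combination h1
      rw [hw₁, hw₂]
      rfl
  · rintro x ⟨⟨θ₁, θ₂, θ₃, a, b, c, h⟩, hKx⟩
    have hdK := h.contDiffAt_curvatureDefect hγ hu
    refine ⟨fun y => (G₁ y, K y), (fderiv ℝ G₁ x).prod (fderiv ℝ K x),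
      -- Choosing the first coordinate restricts the kernel to variations with t₁ fixed.
      ContinuousLinearMap.fst ℝ ℝ (ℝ × ℝ),
      (hdG₁.contDiffAt.hasStrictFDerivAt one_ne_zero).prodMk
        (hdK.hasStrictFDerivAt one_ne_zero), ?_, ?_⟩
    · rintro y ⟨⟨_, _, _, _, _, _, hy⟩, hy0⟩
      exact Prod.ext (hy.reflectionDefect_eq_zero hu) hy0
    · rintro ⟨w₁, w₂, w₃⟩ hw (rfl : w₁ = 0)
      have h1 : fderiv ℝ G₁ x (0, w₂, w₃) = 0 := congrArg Prod.fst hw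
      have h2 : fderiv ℝ K x (0, w₂, w₃) = 0 := congrArg Prod.snd hw
      rw [h.fderiv_reflectionDefect hγ hu] at h1
      have h4 := (hdK.differentiableAt one_ne_zero).hasFDerivAt.hasDerivAt_line (0, w₂, w₃)
      simp only [mul_zero, add_zero, zero_add] at h1 h4
      rw [h4.unique (h.hasDerivAt_curvatureDefect hγ hu w₂ w₃)] at h2
      have hk : Real.sin θ₁ * (b + c - a) - 2 * signedCurvature γ x.1 * b * c = 0 := by
        have h0 : curvatureDefect γ x.1 x.2.1 x.2.2 = 0 := hKx
        rw [h.curvatureDefect_eq hu] at h0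
        exact (mul_eq_zero.1 h0).resolve_left h.c_pos.ne'
      have hs₃c := (mul_pos h.c_pos h.sin₃_pos).ne'
      have hw₂ : w₂ = 0 := by
        refine (mul_eq_zero.1 ?_).resolve_left
          (mul_ne_zero h.b_pos.ne' (h.variation_ne_zero hu))
        -- `hk` eliminates κ and `h1` eliminates w₃.
        linear_combination b * Real.sin θ₃ * h2 -
          Real.sin θ₃ * (-(Real.cos θ₃ * w₃) * c + 2 * b * (Real.cos θ₂ * w₂)) * hk -
          (Real.sin θ₁ * (b + c - a) - 2 * b * Real.sin θ₁) * Real.cos θ₃ * h1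
      have hw₃ : w₃ = 0 := by
        subst hw₂
        refine (mul_eq_zero.1 ?_).resolve_left hs₃c
        linear_combination h1
      rw [hw₂, hw₃]
      rfl

/-! ### From triangles back to phase points -/

namespace IsReflectedTriangle

variable {γ : ℝ → ℂ} {t₁ t₂ t₃ θ₁ θ₂ θ₃ a b c : ℝ}

theorem log_conj_mul_side_im (h : IsReflectedTriangle γ t₁ t₂ t₃ θ₁ θ₂ θ₃ a b c)
    (hu : ∀ t, ‖deriv γ t‖ = 1) (hθ : θ₁ ∈ Ioo 0 Real.pi) :
    (Complex.log (starRingEnd ℂ (deriv γ t₁) * (γ t₂ - γ t₁))).im = θ₁ := by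
  rw [h.conj_mul_side hu, Complex.log_im, Complex.arg_real_mul _ h.c_pos, Complex.arg_exp_mul_I,
    toIocMod_eq_self]
  exact ⟨by linarith [hθ.1, Real.pi_pos], by linarith [hθ.2]⟩

/-- The argument of the logarithm is c·exp(iθ₁), which has positive imaginary part and so avoids the
branch cut. -/
theorem contDiffAt_log (h : IsReflectedTriangle γ t₁ t₂ t₃ θ₁ θ₂ θ₃ a b c)
    (hγ : ContDiff ℝ 3 γ) (hu : ∀ t, ‖deriv γ t‖ = 1) :
    ContDiffAt ℝ 1 (fun y : ℝ × ℝ × ℝ =>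
      (Complex.log (starRingEnd ℂ (deriv γ y.1) * (γ y.2.1 - γ y.1))).im) (t₁, t₂, t₃) := by
  have hγ1 : ContDiff ℝ 1 γ := hγ.of_le (by norm_num)
  have hd : ContDiff ℝ 2 (deriv γ) := hγ.deriv'
  have hd1 : ContDiff ℝ 1 (deriv γ) := hd.of_le (by norm_num)
  have p₁ : ContDiff ℝ 1 (fun y : ℝ × ℝ × ℝ => y.1) := contDiff_fst
  have p₂ : ContDiff ℝ 1 (fun y : ℝ × ℝ × ℝ => y.2.1) := contDiff_fst.comp contDiff_snd
  have hin : ContDiffAt ℝ 1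
      (fun y : ℝ × ℝ × ℝ => starRingEnd ℂ (deriv γ y.1) * (γ y.2.1 - γ y.1)) (t₁, t₂, t₃) :=
    ((Complex.conjCLE.contDiff.comp (hd1.comp p₁)).mul
      ((hγ1.comp p₂).sub (hγ1.comp p₁))).contDiffAt
  have hslit : starRingEnd ℂ (deriv γ t₁) * (γ t₂ - γ t₁) ∈ Complex.slitPlane := by
    rw [h.conj_mul_side hu]
    refine Complex.mem_slitPlane_iff.2 (Or.inr ?_)
    rw [Complex.im_ofReal_mul, Complex.exp_ofReal_mul_I_im]
    exact (mul_pos h.c_pos h.sin₁_pos).ne'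
  have hlog : ContDiffAt ℝ 1 Complex.log (starRingEnd ℂ (deriv γ t₁) * (γ t₂ - γ t₁)) :=
    (Complex.contDiffAt_log hslit).restrict_scalars ℝ
  exact Complex.imCLM.contDiff.contDiffAt.comp _
    (ContDiffAt.comp (t₁, t₂, t₃) hlog hin)

end IsReflectedTriangle

namespace BilliardTable

variable (B : BilliardTable)

/-- The parameters and angle of a reflected triangle at its first vertex. -/
noncomputable def firstVertex (x : ℝ × ℝ × ℝ) : AddCircle B.length × ℝ :=
  ((x.1 : AddCircle B.length),
    (Complex.log (starRingEnd ℂ (deriv B.γ x.1) * (B.γ x.2.1 - B.γ x.1))).im)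

theorem isReflectedTriangle_of_collides {t₁ t₂ t₃ : ℝ} {θ₁ θ₂ θ₃ : Ioo (0 : ℝ) Real.pi}
    (h₁ : B.Collides ((t₁ : AddCircle B.length), θ₁) ((t₂ : AddCircle B.length), θ₂))
    (h₂ : B.Collides ((t₂ : AddCircle B.length), θ₂) ((t₃ : AddCircle B.length), θ₃))
    (h₃ : B.Collides ((t₃ : AddCircle B.length), θ₃) ((t₁ : AddCircle B.length), θ₁)) :
    ∃ a b c, IsReflectedTriangle B.γ t₁ t₂ t₃ θ₁ θ₂ θ₃ a b c := by
  obtain ⟨c, hc, hc1, -, -, hc2⟩ := h₁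
  obtain ⟨a, ha, ha1, -, -, ha2⟩ := h₂
  obtain ⟨b, hb, hb1, -, -, hb2⟩ := h₃
  have hs : ∀ θ : Ioo (0 : ℝ) Real.pi, 0 < Real.sin θ := fun θ =>
    Real.sin_pos_of_pos_of_lt_pi θ.2.1 θ.2.2
  have side : ∀ {z w d : ℂ}, w = z + d → w - z = d := fun h => by rw [h]; ring
  have dir : ∀ {z w : ℂ} (θ : ℝ), z * Complex.exp (-(θ * Complex.I)) = w →
      z = w * Complex.exp (θ * Complex.I) := fun {z w} θ h => by
    rw [← h]
    linear_combination -z * Complex.exp_mul_I_mul_exp_neg θ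
  exact ⟨a, b, c, ha, hb, hc, hs θ₁, hs θ₂, hs θ₃, side hc1, side ha1, side hb1,
    dir θ₂ hc2, dir θ₃ ha2, dir θ₁ hb2⟩

theorem image_P3_subset :
    Prod.map id Subtype.val '' B.P3 ⊆ B.firstVertex '' reflectedTriangles B.γ := by
  rintro _ ⟨⟨t₁, θ₁⟩, hp, rfl⟩
  obtain ⟨⟨t₃, θ₃⟩, hp, h₃⟩ := Part.mem_bind_iff.1 hp
  obtain ⟨⟨t₂, θ₂⟩, h₁, h₂⟩ := Part.mem_bind_iff.1 hp
  rw [mem_T] at h₁ h₂ h₃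
  induction t₁ using QuotientAddGroup.induction_on with | H t₁ => ?_
  induction t₂ using QuotientAddGroup.induction_on with | H t₂ => ?_
  induction t₃ using QuotientAddGroup.induction_on with | H t₃ => ?_
  obtain ⟨a, b, c, h⟩ := B.isReflectedTriangle_of_collides h₁ h₂ h₃
  exact ⟨(t₁, t₂, t₃), ⟨_, _, _, _, _, _, h⟩,
    Prod.ext rfl (h.log_conj_mul_side_im B.norm_deriv_γ θ₁.2)⟩

theorem dimH_P3_le_one : dimH B.P3 ≤ 1 := by
  have hiso : Isometry (Prod.map id Subtype.val : B.Phase → AddCircle B.length × ℝ) :=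
    isometry_id.prodMap isometry_subtype_coe
  rw [← hiso.dimH_image]
  refine (dimH_mono B.image_P3_subset).trans ((dimH_image_le_of_locally_lipschitzOn ?_).trans
    (dimH_reflectedTriangles_le_one B.contDiff_γ B.norm_deriv_γ))
  rintro ⟨t₁, t₂, t₃⟩ ⟨θ₁, θ₂, θ₃, a, b, c, h⟩
  obtain ⟨C, U, hU, hC⟩ :=
    (h.contDiffAt_log B.contDiff_γ B.norm_deriv_γ).exists_lipschitzOnWith
  have hcoe : LipschitzWith 1 (fun t : ℝ => (t : AddCircle B.length)) :=
    LipschitzWith.of_dist_le_mul fun s t => by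
      rw [dist_eq_norm, dist_eq_norm, ← AddCircle.coe_sub, NNReal.coe_one, one_mul]
      exact QuotientAddGroup.norm_mk_le_norm
  exact ⟨_, U, mem_nhdsWithin_of_mem_nhds hU,
    ((hcoe.comp LipschitzWith.prod_fst).lipschitzOnWith).prodMk hC⟩

end BilliardTable

theorem theorem1 (B : BilliardTable) :
    dimH B.P3 ≤ 1 ∧ ∀ s : ℝ, 1 < s → Measure.hausdorffMeasure s B.P3 = 0 := by
  refine ⟨B.dimH_P3_le_one, fun s hs => ?_⟩
  lift s to NNReal using by linarith
  refine hausdorffMeasure_of_dimH_lt (B.dimH_P3_le_one.trans_lt ?_)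
  exact_mod_cast hs
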